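/- Let $S_n$ be the set of permutations of $\{1,\dots,n\}$. For $\pi\in S_n$ let $\mathrm{fp}(\pi)=\#\{i:\pi_i=i\}$ and $\mathrm{exc}(\pi)=\#\{i:\pi_i>i\}$. For a pattern $\sigma\in S_m$, $\pi$ avoids $\sigma$ if no subsequence $\pi_{i_1}\cdots\pi_{i_m}$ with $i_1<\dots<i_m$ is in the same relative order as $\sigma_1\cdots\sigma_m$; let $S_n(\sigma)$ be the set of $\sigma$-avoiding permutations in $S_n$, and put $$F_\sigma(x,q,z)=\sum_{n\ge 0}\ \sum_{\pi\in S_n(\sigma)}x^{\mathrm{fp}(\pi)}q^{\mathrm{exc}(\pi)}z^n ,$$ a formal power series in $z$ with coefficients in $\mathbb{Z}[x,q]$ (or, more generally, with $x,q$ elements of any commutative ring). Let $C_j=\frac1{j+1}\binom{2j}{j}$ be the Catalan numbers and $C_{<n}(z)=\sum_{j=0}^{n-1}C_jz^j$. An infinite continued fraction in power series means the limit of its finite truncations, each coefficient being eventually constant. **Theorem.** 1. With $K_n=(x-1)C_nq^nz^n+(q-1)C_{<n}(qz)$ for $n\ge 0$, $$F_{312}(x,q,z)=\cfrac{1}{1-zK_0-\cfrac{z}{1-zK_1-\cfrac{z}{1-zK_2-\cfrac{z}{1-zK_3-\cfrac{z}{\ddots}}}}}.$$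 2. In particular, for $q=1$, $$F_{312}(x,1,z)=\cfrac{1}{1-(x-1)C_0z-\cfrac{z}{1-(x-1)C_1z^2-\cfrac{z}{1-(x-1)C_2z^3-\cfrac{z}{1-(x-1)C_3z^4-\cfrac{z}{\ddots}}}}}.$$ 3. If $q$ is invertible, then $F_{231}(x,q,z)=F_{312}\left(\frac{x}{q},\frac1q,qz\right)$. For every $q$, with $K'_n=(x-q)C_nz^n+(1-q)C_{<n}(z)$, $$F_{231}(x,q,z)=\cfrac{1}{1-zK'_0-\cfrac{qz}{1-zK'_1-\cfrac{qz}{1-zK'_2-\cfrac{qz}{1-zK'_3-\cfrac{qz}{\ddots}}}}}.$$ -/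

import Mathlib

open PowerSeries

/-- The permutation `π` contains the pattern `σ`: some subsequence of `π 0, π 1, …, π (n-1)` is in
the same relative order as `σ 0, …, σ (m-1)`. -/
def ContainsPattern {m n : ℕ} (σ : Equiv.Perm (Fin m)) (π : Equiv.Perm (Fin n)) : Prop :=
  ∃ e : Fin m → Fin n, (∀ a b, a < b → e a < e b) ∧
    ∀ a b, π (e a) < π (e b) ↔ σ a < σ b

instance {m n : ℕ} (σ : Equiv.Perm (Fin m)) (π : Equiv.Perm (Fin n)) :
    Decidable (ContainsPattern σ π) :=
  inferInstanceAs (Decidable (∃ e : Fin m → Fin n, (∀ a b, a < b → e a < e b) ∧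
    ∀ a b, π (e a) < π (e b) ↔ σ a < σ b))

/-- The finite set of permutations of `n` letters that avoid the pattern `σ`. -/
def avoiders {m : ℕ} (σ : Equiv.Perm (Fin m)) (n : ℕ) : Finset (Equiv.Perm (Fin n)) :=
  Finset.univ.filter fun π => ¬ ContainsPattern σ π

/-- The number of fixed points. -/
def fp {n : ℕ} (π : Equiv.Perm (Fin n)) : ℕ :=
  (Finset.univ.filter fun i => π i = i).card

/-- The number of excedances, that is, of indices `i` with `π i > i`. -/
def exc {n : ℕ} (π : Equiv.Perm (Fin n)) : ℕ :=
  (Finset.univ.filter fun i => i < π i).card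

/-- The pattern 312 (written with letters `0, 1, 2` in place of `1, 2, 3`). -/
def pattern312 : Equiv.Perm (Fin 3) where
  toFun := ![2, 0, 1]
  invFun := ![1, 2, 0]
  left_inv := by decide
  right_inv := by decide

/-- The pattern 231 (written with letters `0, 1, 2` in place of `1, 2, 3`). -/
def pattern231 : Equiv.Perm (Fin 3) where
  toFun := ![1, 2, 0]
  invFun := ![2, 0, 1]
  left_inv := by decide
  right_inv := by decide

noncomputable section

/-- The generating function `F_σ(x, q, z) = ∑ₙ ∑_π x ^ fp(π) q ^ exc(π) zⁿ`, the inner sum over the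
`σ`-avoiding permutations of `n` letters, as a formal power series in `z` with coefficients in a
commutative ring `R` containing `x` and `q`; for `R = ℤ[x, q]` it is the generating function in
three indeterminates. -/
def permGF {R : Type*} [CommRing R] {m : ℕ} (σ : Equiv.Perm (Fin m)) (x q : R) : R⟦X⟧ :=
  PowerSeries.mk fun n => ∑ π ∈ avoiders σ n, x ^ fp π * q ^ exc π

/-- The Catalan series truncated at degree `n`, evaluated at `w`: `∑_{j < n} C_j w ^ j`. -/
def truncCatalan {R : Type*} [CommRing R] (n : ℕ) (w : R⟦X⟧) : R⟦X⟧ :=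
  ∑ j ∈ Finset.range n, (catalan j : R⟦X⟧) * w ^ j

/-- `K_n = (x - 1) C_n qⁿ zⁿ + (q - 1) C_{<n}(q z)`. -/
def coeffK {R : Type*} [CommRing R] (x q : R) (n : ℕ) : R⟦X⟧ :=
  C (x - 1) * (catalan n : R⟦X⟧) * C q ^ n * X ^ n + C (q - 1) * truncCatalan n (C q * X)

/-- `K'_n = (x - q) C_n zⁿ + (1 - q) C_{<n}(z)`. -/
def coeffK' {R : Type*} [CommRing R] (x q : R) (n : ℕ) : R⟦X⟧ :=
  C (x - q) * (catalan n : R⟦X⟧) * X ^ n + C (1 - q) * truncCatalan n X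

/-- The finite continued fraction that starts at level `i` and has `h` levels,
`1 / (1 - z K_i - c z / (1 - z K_{i+1} - c z / ( … / (1 - z K_{i+h-1}))))`.
Every denominator is a power series with constant coefficient `1`, so `invOfUnit _ 1` is its
inverse; see `contFracTrunc_succ_mul`. -/
def contFracTrunc {R : Type*} [CommRing R] (c : R) (K : ℕ → R⟦X⟧) : ℕ → ℕ → R⟦X⟧
  | 0, _ => 0
  | h + 1, i => invOfUnit (1 - X * K i - C c * X * contFracTrunc c K h (i + 1)) 1

theorem contFracTrunc_succ_mul {R : Type*} [CommRing R] (c : R) (K : ℕ → R⟦X⟧) (h i : ℕ) :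
    (1 - X * K i - C c * X * contFracTrunc c K h (i + 1)) * contFracTrunc c K (h + 1) i = 1 := by
  rw [contFracTrunc]
  exact mul_invOfUnit _ _ (by simp)

/-- `F` is the value of the infinite continued fraction
`1 / (1 - z K_0 - c z / (1 - z K_1 - c z / (1 - z K_2 - ⋯)))`: the finite truncations converge to
`F` as formal power series, that is, each coefficient is eventually that of `F`. -/
def IsContFrac {R : Type*} [CommRing R] (F : R⟦X⟧) (c : R) (K : ℕ → R⟦X⟧) : Prop :=
  ∀ n : ℕ, ∀ᶠ h in Filter.atTop, coeff n (contFracTrunc c K h 0) = coeff n F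

end

/-!
The proof refines the statistics by a shift. For `s : ℕ` and a permutation `π` let every position
`a` have weight `x`, `q` or `t` according to whether `π a + s` is equal to, greater than, or less
than `a`, and let `F s` (`shiftedGF`) be the generating function of the `312`-avoiding permutations
with the product of these weights.

If the smallest letter of a `312`-avoiding permutation stands at position `i`, all letters before
it are smaller than all letters after it. So the permutation is glued (`glue`) from a `312`-avoiding
permutation `α` of `i` letters, whose values are moved up by one, the smallest letter, and a
`312`-avoiding permutation `β` of the remaining letters, whose positions and values move up by the
same amount. The values of `α` gain one on their positions, so `α` is counted with shift `s + 1` and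
`β` with shift `s`. The smallest letter itself has weight `q` for `i < s`, `x` for `i = s` and `t`
for `s < i`. For `i ≤ s` every position of `α` is an excedance for the shift `s + 1`, so these `α`
contribute `catalan i * q ^ i`. Together this is
`F s = 1 + X * (K s + t * F (s + 1)) * F s` (`shiftedGF_eq`), which is one level of the continued
fraction; each further level makes one more coefficient correct (`X_pow_dvd_sub_contFracTrunc`).

The series for `312` is `F 0` with weights `(x, q, 1)`. Inversion exchanges the patterns `231` and
`312` as well as excedances and deficiencies, so the series for `231` is `F 0` with weights
`(x, 1, q)`.
-/

/-! ### The two patterns and inversion -/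

theorem containsPattern312_iff {n : ℕ} (π : Equiv.Perm (Fin n)) :
    ContainsPattern pattern312 π ↔ ∃ a b c, a < b ∧ b < c ∧ π b < π c ∧ π c < π a := by
  constructor
  · rintro ⟨e, he, h⟩
    exact ⟨e 0, e 1, e 2, he _ _ (by decide), he _ _ (by decide), (h 1 2).2 (by decide),
      (h 2 0).2 (by decide)⟩
  · rintro ⟨a, b, c, hab, hbc, h1, h2⟩
    refine ⟨![a, b, c], ?_, ?_⟩
    · intro i j
      fin_cases i <;> fin_cases j <;> simp [hab, hbc, hab.trans hbc]
    · intro i j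
      fin_cases i <;> fin_cases j <;>
        simp [pattern312, h1, h2, h1.trans h2, h1.le, h2.le, (h1.trans h2).le]

theorem containsPattern231_iff {n : ℕ} (π : Equiv.Perm (Fin n)) :
    ContainsPattern pattern231 π ↔ ∃ a b c, a < b ∧ b < c ∧ π c < π a ∧ π a < π b := by
  constructor
  · rintro ⟨e, he, h⟩
    exact ⟨e 0, e 1, e 2, he _ _ (by decide), he _ _ (by decide), (h 2 0).2 (by decide),
      (h 0 1).2 (by decide)⟩
  · rintro ⟨a, b, c, hab, hbc, h1, h2⟩
    refine ⟨![a, b, c], ?_, ?_⟩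
    · intro i j
      fin_cases i <;> fin_cases j <;> simp [hab, hbc, hab.trans hbc]
    · intro i j
      fin_cases i <;> fin_cases j <;>
        simp [pattern231, h1, h2, h1.trans h2, h1.le, h2.le, (h1.trans h2).le]

theorem mem_avoiders312_iff {n : ℕ} {π : Equiv.Perm (Fin n)} :
    π ∈ avoiders pattern312 n ↔ ∀ a b c, a < b → b < c → π b < π c → ¬ π c < π a := by
  simp only [avoiders, Finset.mem_filter, Finset.mem_univ, true_and, containsPattern312_iff]
  grind

theorem inv_mem_avoiders231_iff {n : ℕ} {π : Equiv.Perm (Fin n)} :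
    π⁻¹ ∈ avoiders pattern231 n ↔ π ∈ avoiders pattern312 n := by
  simp only [avoiders, Finset.mem_filter, Finset.mem_univ, true_and, containsPattern312_iff,
    containsPattern231_iff, not_iff_not]
  constructor
  · rintro ⟨a, b, c, hab, hbc, h1, h2⟩
    exact ⟨π⁻¹ c, π⁻¹ a, π⁻¹ b, h1, h2, by simpa using hab, by simpa using hbc⟩
  · rintro ⟨a, b, c, hab, hbc, h1, h2⟩
    exact ⟨π b, π c, π a, h1, h2, by simpa using hab, by simpa using hbc⟩

/-! ### Shifted weights -/

/-- The weight of the position `a` with (shifted) value `b`: `x` for a fixed point, `q` for an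
excedance, `t` for a deficiency. -/
def stepWeight {R : Type*} (x q t : R) (a b : ℕ) : R :=
  if b = a then x else if a < b then q else t

/-- The product over all positions `a` of the weights of `a` and `π a + s`. -/
def shiftedWeight {R : Type*} [CommSemiring R] (x q t : R) (s : ℕ) {n : ℕ}
    (π : Equiv.Perm (Fin n)) : R :=
  ∏ a : Fin n, stepWeight x q t a (π a + s)

/-- The total shifted weight of the `312`-avoiding permutations of `n` letters. -/
def shiftedSum {R : Type*} [CommSemiring R] (x q t : R) (s n : ℕ) : R :=
  ∑ π ∈ avoiders pattern312 n, shiftedWeight x q t s π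

theorem shiftedWeight_zero_eq {R : Type*} [CommSemiring R] (x q : R) {n : ℕ}
    (π : Equiv.Perm (Fin n)) : shiftedWeight x q 1 0 π = x ^ fp π * q ^ exc π := by
  simp only [fp, exc, ← Finset.prod_const, Finset.prod_filter, ← Finset.prod_mul_distrib,
    shiftedWeight]
  refine Finset.prod_congr rfl fun a _ => ?_
  simp only [stepWeight, add_zero, Fin.lt_def, Fin.ext_iff]
  grind

theorem shiftedWeight_zero_eq_inv {R : Type*} [CommSemiring R] (x q : R) {n : ℕ}
    (π : Equiv.Perm (Fin n)) : shiftedWeight x 1 q 0 π = x ^ fp π⁻¹ * q ^ exc π⁻¹ := by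
  simp only [fp, exc, ← Finset.prod_const, Finset.prod_filter, ← Finset.prod_mul_distrib,
    shiftedWeight]
  symm
  rw [← Equiv.prod_comp π]
  refine Finset.prod_congr rfl fun a _ => ?_
  have h : π⁻¹ (π a) = a := by simp
  simp only [h, stepWeight, add_zero, Fin.lt_def, Fin.ext_iff]
  grind

/-- For `n ≤ s` every position is an excedance for the shift `s + 1`. -/
theorem shiftedWeight_of_le {R : Type*} [CommSemiring R] (x q t : R) {s n : ℕ} (h : n ≤ s)
    (π : Equiv.Perm (Fin n)) : shiftedWeight x q t (s + 1) π = q ^ n := by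
  rw [shiftedWeight, Finset.prod_congr rfl (g := fun _ => q)]
  · simp
  · intro a _
    have := a.isLt
    rw [stepWeight, if_neg (by omega), if_pos (by omega)]

/-! ### Decomposition at the smallest letter -/

/-- The one-line word of `glue α β`: the word of `α` with its values moved up by one, the letter
`0`, and the word of `β` with its values moved up by `i + 1`. -/
def glueFun {i j : ℕ} (α : Equiv.Perm (Fin i)) (β : Equiv.Perm (Fin j)) :
    Fin (i + (j + 1)) → Fin (i + (j + 1)) :=
  Fin.append (fun a => ⟨α a + 1, by have := (α a).isLt; omega⟩)
    (Fin.cons ⟨0, by omega⟩ fun b => Fin.natAdd i (β b).succ)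

theorem glueFun_injective {i j : ℕ} (α : Equiv.Perm (Fin i)) (β : Equiv.Perm (Fin j)) :
    Function.Injective (glueFun α β) := by
  intro a b
  refine Fin.addCases (fun a => ?_) (fun a => Fin.cases ?_ (fun a => ?_) a) a <;>
    refine Fin.addCases (fun b => ?_) (fun b => Fin.cases ?_ (fun b => ?_) b) b <;>
    simp only [glueFun, Fin.append_left, Fin.append_right, Fin.cons_zero, Fin.cons_succ,
      Fin.ext_iff, Fin.val_natAdd, Fin.val_castAdd, Fin.val_succ, Fin.val_zero, implies_true]
  · intro h
    rw [← Fin.ext_iff]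
    exact α.injective (Fin.ext (by omega))
  all_goals
    first
    | omega
    | (intro h
       have h' : β a = β b := Fin.ext (by omega)
       rw [β.injective h'])

/-- The permutation composed of `α` with its values moved up by one, the smallest letter, and `β`
with its values moved up by `i + 1`. -/
noncomputable def glue {i j : ℕ} (α : Equiv.Perm (Fin i)) (β : Equiv.Perm (Fin j)) :
    Equiv.Perm (Fin (i + (j + 1))) :=
  Equiv.ofBijective (glueFun α β) (Finite.injective_iff_bijective.1 (glueFun_injective α β))

section glue

variable {i j : ℕ} (α : Equiv.Perm (Fin i)) (β : Equiv.Perm (Fin j))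

theorem val_glue_castAdd (a : Fin i) : (glue α β (Fin.castAdd (j + 1) a) : ℕ) = α a + 1 := by
  simp [glue, glueFun]

theorem val_glue_natAdd_zero : (glue α β (Fin.natAdd i 0) : ℕ) = 0 := by
  simp [glue, glueFun, -Fin.natAdd_zero]

theorem val_glue_natAdd_succ (b : Fin j) :
    (glue α β (Fin.natAdd i b.succ) : ℕ) = i + (β b + 1) := by
  simp [glue, glueFun]

theorem shiftedWeight_glue {R : Type*} [CommSemiring R] (x q t : R) (s : ℕ) :
    shiftedWeight x q t s (glue α β) =
      shiftedWeight x q t (s + 1) α * stepWeight x q t i s * shiftedWeight x q t s β := by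
  simp only [shiftedWeight]
  rw [Fin.prod_univ_add, Fin.prod_univ_succ, mul_assoc]
  congr 1
  · refine Finset.prod_congr rfl fun a _ => ?_
    rw [val_glue_castAdd, Fin.val_castAdd, add_assoc, add_comm 1 s]
  · congr 1
    · rw [val_glue_natAdd_zero]
      simp
    · refine Finset.prod_congr rfl fun b _ => ?_
      rw [val_glue_natAdd_succ]
      simp only [stepWeight, Fin.val_natAdd, Fin.val_succ]
      congr 1
      · exact propext ⟨fun h => by omega, fun h => by omega⟩
      · congr 1
        exact propext ⟨fun h => by omega, fun h => by omega⟩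

theorem glue_mem_avoiders_iff :
    glue α β ∈ avoiders pattern312 (i + (j + 1)) ↔
      α ∈ avoiders pattern312 i ∧ β ∈ avoiders pattern312 j := by
  simp only [mem_avoiders312_iff]
  constructor
  · refine fun h => ⟨fun a b c hab hbc h1 h2 => ?_, fun a b c hab hbc h1 h2 => ?_⟩
    · refine h (Fin.castAdd _ a) (Fin.castAdd _ b) (Fin.castAdd _ c) hab hbc ?_ ?_ <;>
        simp only [Fin.lt_def, val_glue_castAdd] at * <;> omega
    · refine h (Fin.natAdd i a.succ) (Fin.natAdd i b.succ) (Fin.natAdd i c.succ) ?_ ?_ ?_ ?_ <;>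
        simp only [Fin.lt_def, val_glue_natAdd_succ, Fin.val_natAdd, Fin.val_succ] at * <;> omega
  · rintro ⟨hα, hβ⟩ a b c
    refine Fin.addCases (fun a => ?_) (fun a => Fin.cases ?_ (fun a => ?_) a) a <;>
      refine Fin.addCases (fun b => ?_) (fun b => Fin.cases ?_ (fun b => ?_) b) b <;>
      refine Fin.addCases (fun c => ?_) (fun c => Fin.cases ?_ (fun c => ?_) c) c <;>
      simp only [Fin.lt_def, val_glue_castAdd, val_glue_natAdd_zero, val_glue_natAdd_succ,
        Fin.val_natAdd, Fin.val_castAdd, Fin.val_succ, Fin.val_zero] <;>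
      intro hab hbc h1 h2
    · exact hα a b c hab hbc (Fin.lt_def.2 (by omega)) (Fin.lt_def.2 (by omega))
    all_goals
      first
      | omega
      | exact hβ a b c (Fin.lt_def.2 (by omega)) (Fin.lt_def.2 (by omega))
          (Fin.lt_def.2 (by omega)) (Fin.lt_def.2 (by omega))

theorem glue_injective {α α' : Equiv.Perm (Fin i)} {β β' : Equiv.Perm (Fin j)}
    (h : glue α β = glue α' β') : α = α' ∧ β = β' := by
  constructor
  · ext a
    have := congrArg (fun π => (π (Fin.castAdd (j + 1) a) : ℕ)) h
    simp only [val_glue_castAdd] at this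
    omega
  · ext b
    have := congrArg (fun π => (π (Fin.natAdd i b.succ) : ℕ)) h
    simp only [val_glue_natAdd_succ] at this
    omega

end glue

/-- Every `312`-avoiding permutation is glued at the position of its smallest letter. -/
theorem exists_glue_eq {i j : ℕ} {π : Equiv.Perm (Fin (i + (j + 1)))}
    (hπ : π ∈ avoiders pattern312 _) (h0 : (π (Fin.natAdd i 0) : ℕ) = 0) :
    ∃ α β, glue α β = π := by
  rw [mem_avoiders312_iff] at hπ
  have hpos : ∀ a, a ≠ Fin.natAdd i 0 → 0 < (π a : ℕ) := fun a ha =>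
    Nat.pos_of_ne_zero fun h => ha (π.injective (Fin.ext (by omega)))
  have hne : ∀ a : Fin i, Fin.castAdd (j + 1) a ≠ Fin.natAdd i 0 := fun a h => by
    have := congrArg Fin.val h
    have := a.isLt
    simp at *
    omega
  have hne' : ∀ b : Fin j, Fin.natAdd i b.succ ≠ Fin.natAdd i 0 := fun b h => by
    have := congrArg Fin.val h
    simp at this
  -- With the smallest letter in between, a larger letter before a smaller one would give a `312`.
  have hlt : ∀ (a : Fin i) (b : Fin j),
      π (Fin.castAdd (j + 1) a) < π (Fin.natAdd i b.succ) := by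
    intro a b
    refine lt_of_le_of_ne (not_lt.1 (hπ _ (Fin.natAdd i 0) _ ?_ ?_ ?_)) fun h => ?_
    · have := a.isLt
      simp only [Fin.lt_def, Fin.val_castAdd, Fin.val_natAdd]
      omega
    · simp only [Fin.lt_def, Fin.val_natAdd, Fin.val_succ, Fin.val_zero]
      omega
    · rw [Fin.lt_def, h0]
      exact hpos _ (hne' b)
    · have := congrArg Fin.val (π.injective h)
      have := a.isLt
      simp at *
      omega
  -- At least `j` letters exceed a letter before the smallest one.
  have hA : ∀ a : Fin i, (π (Fin.castAdd (j + 1) a) : ℕ) ≤ i := by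
    intro a
    have h := Finset.card_le_card_of_injOn (s := (Finset.univ : Finset (Fin j)))
      (t := Finset.Ioi (π (Fin.castAdd (j + 1) a))) (fun b => π (Fin.natAdd i b.succ))
      (fun b _ => by simpa using hlt a b)
      (fun b _ b' _ hb => by simpa using π.injective hb)
    rw [Finset.card_univ, Fintype.card_fin, Fin.card_Ioi] at h
    have := (π (Fin.castAdd (j + 1) a)).isLt
    omega
  -- At least `i + 1` letters, the smallest one included, are below a letter after it.
  have hB : ∀ b : Fin j, i + 1 ≤ (π (Fin.natAdd i b.succ) : ℕ) := by
    intro b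
    have h := Finset.card_le_card_of_injOn (s := (Finset.univ : Finset (Fin (i + 1))))
      (t := Finset.Iio (π (Fin.natAdd i b.succ)))
      (fun a => π ⟨a, by have := a.isLt; omega⟩)
      (fun a _ => by
        simp only [Finset.coe_Iio, Set.mem_Iio]
        rcases Nat.lt_succ_iff_lt_or_eq.1 a.isLt with ha | ha
        · exact hlt ⟨a, ha⟩ b
        · have : (⟨a, by omega⟩ : Fin (i + (j + 1))) = Fin.natAdd i 0 := Fin.ext (by simp [ha])
          rw [this, Fin.lt_def, h0]
          exact hpos _ (hne' b))
      (fun a _ a' _ h => by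
        have := congrArg Fin.val (π.injective h)
        exact Fin.ext this)
    rw [Finset.card_univ, Fintype.card_fin, Fin.card_Iio] at h
    exact h
  let f : Fin i → Fin i := fun a => ⟨(π (Fin.castAdd (j + 1) a) : ℕ) - 1, by
    have := hA a
    have := a.isLt
    omega⟩
  let g : Fin j → Fin j := fun b => ⟨(π (Fin.natAdd i b.succ) : ℕ) - (i + 1), by
    have := hB b
    have := (π (Fin.natAdd i b.succ)).isLt
    omega⟩
  have hf : Function.Injective f := fun a a' h => by
    have h1 := congrArg Fin.val h
    have h2 := hpos _ (hne a)
    have h3 := hpos _ (hne a')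
    simp only [f] at h1
    have h4 : π (Fin.castAdd (j + 1) a) = π (Fin.castAdd (j + 1) a') := Fin.ext (by omega)
    simpa using π.injective h4
  have hg : Function.Injective g := fun b b' h => by
    have h1 := congrArg Fin.val h
    have h2 := hB b
    have h3 := hB b'
    simp only [g] at h1
    have h4 : π (Fin.natAdd i b.succ) = π (Fin.natAdd i b'.succ) := Fin.ext (by omega)
    simpa using π.injective h4
  refine ⟨Equiv.ofBijective f (Finite.injective_iff_bijective.1 hf),
    Equiv.ofBijective g (Finite.injective_iff_bijective.1 hg), Equiv.ext fun a => Fin.ext ?_⟩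
  refine Fin.addCases (fun a => ?_) (fun a => Fin.cases ?_ (fun a => ?_) a) a
  · have := hpos _ (hne a)
    rw [val_glue_castAdd]
    simp only [Equiv.ofBijective_apply, f]
    omega
  · rw [val_glue_natAdd_zero, h0]
  · have := hB a
    rw [val_glue_natAdd_succ]
    simp only [Equiv.ofBijective_apply, g]
    omega

theorem sum_avoiders_filter_eq {R : Type*} [CommSemiring R] (x q t : R) (s i j : ℕ) :
    ∑ π ∈ avoiders pattern312 (i + (j + 1)) with (π (Fin.natAdd i 0) : ℕ) = 0,
        shiftedWeight x q t s π =
      stepWeight x q t i s * shiftedSum x q t (s + 1) i * shiftedSum x q t s j := by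
  rw [shiftedSum, shiftedSum, mul_assoc, Finset.sum_mul_sum, ← Finset.sum_product',
    Finset.mul_sum]
  symm
  refine Finset.sum_nbij (fun p => glue p.1 p.2) ?_ ?_ ?_ ?_
  · rintro ⟨α, β⟩ h
    rw [Finset.mem_product] at h
    exact Finset.mem_filter.2 ⟨(glue_mem_avoiders_iff α β).2 h, val_glue_natAdd_zero α β⟩
  · rintro ⟨α, β⟩ - ⟨α', β'⟩ - h
    exact Prod.ext_iff.2 (glue_injective h)
  · intro π h
    obtain ⟨h1, h0⟩ := Finset.mem_filter.1 h
    obtain ⟨α, β, rfl⟩ := exists_glue_eq h1 h0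
    exact ⟨(α, β), Finset.mem_product.2 ((glue_mem_avoiders_iff α β).1 h1), rfl⟩
  · rintro ⟨α, β⟩ -
    rw [shiftedWeight_glue]
    ring

theorem shiftedSum_zero {R : Type*} [CommSemiring R] (x q t : R) (s : ℕ) :
    shiftedSum x q t s 0 = 1 := by
  have : avoiders pattern312 0 = Finset.univ :=
    Finset.filter_true_of_mem fun π _ h => (h.choose 0).elim0
  simp [shiftedSum, this, shiftedWeight]

theorem shiftedSum_succ {R : Type*} [CommSemiring R] (x q t : R) (s n : ℕ) :
    shiftedSum x q t s (n + 1) = ∑ p ∈ Finset.HasAntidiagonal.antidiagonal n,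
      stepWeight x q t p.1 s * shiftedSum x q t (s + 1) p.1 * shiftedSum x q t s p.2 := by
  rw [shiftedSum, ← Finset.sum_fiberwise_of_maps_to
    (t := Finset.HasAntidiagonal.antidiagonal n)
    (g := fun π => ((π⁻¹ 0 : Fin (n + 1)).val, n - (π⁻¹ 0 : Fin (n + 1)).val))]
  · refine Finset.sum_congr rfl ?_
    rintro ⟨i, j⟩ hij
    obtain rfl : i + j = n := Finset.HasAntidiagonal.mem_antidiagonal.1 hij
    rw [← sum_avoiders_filter_eq]
    refine Finset.sum_congr (Finset.filter_congr fun π _ => ?_) fun _ _ => rfl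
    have key : (π (Fin.natAdd i (0 : Fin (j + 1))) : ℕ) = 0 ↔
        (π⁻¹ 0 : Fin (i + j + 1)).val = i := by
      rw [show ((π (Fin.natAdd i (0 : Fin (j + 1))) : ℕ) = 0) ↔
        π (Fin.natAdd i (0 : Fin (j + 1))) = 0 from (Fin.ext_iff (b := (0 : Fin (i + j + 1)))).symm,
        ← Equiv.Perm.eq_inv_iff_eq, eq_comm, Fin.ext_iff]
      simp
    rw [key, Prod.mk.injEq]
    constructor
    · exact fun h => h.1
    · exact fun h => ⟨h, by omega⟩
  · intro π _
    have := (π⁻¹ 0 : Fin (n + 1)).isLt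
    exact Finset.HasAntidiagonal.mem_antidiagonal.2 (by omega)

theorem card_avoiders312 (n : ℕ) : (avoiders pattern312 n).card = catalan n := by
  -- With all weights equal to `1` the recurrence is that of the Catalan numbers.
  have hcard : ∀ s n, shiftedSum (1 : ℕ) 1 1 s n = (avoiders pattern312 n).card := by
    simp [shiftedSum, shiftedWeight, stepWeight]
  induction n using Nat.strong_induction_on with
  | _ n ih =>
    cases n with
    | zero => rw [← hcard 0, shiftedSum_zero, catalan_zero]
    | succ n =>
      rw [← hcard 0, shiftedSum_succ, catalan_succ']
      refine Finset.sum_congr rfl fun p hp => ?_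
      have := Finset.HasAntidiagonal.mem_antidiagonal.1 hp
      rw [hcard, hcard, ih _ (by omega), ih _ (by omega)]
      simp [stepWeight]

theorem shiftedSum_of_le {R : Type*} [CommSemiring R] (x q t : R) {s n : ℕ} (h : n ≤ s) :
    shiftedSum x q t (s + 1) n = catalan n * q ^ n := by
  simp [shiftedSum, shiftedWeight_of_le x q t h, card_avoiders312]

/-! ### The continued fraction -/

section series

variable {R : Type*} [CommRing R]

/-- The generating function of the `312`-avoiding permutations by shifted weight. -/
noncomputable def shiftedGF (x q t : R) (s : ℕ) : R⟦X⟧ :=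
  PowerSeries.mk (shiftedSum x q t s)

/-- The partial denominators for three weights,
`(x - t) C_n qⁿ zⁿ + (q - t) C_{<n}(q z)`. -/
noncomputable def weightedCoeff (x q t : R) (n : ℕ) : R⟦X⟧ :=
  C (x - t) * (catalan n : R⟦X⟧) * C q ^ n * X ^ n + C (q - t) * truncCatalan n (C q * X)

theorem coeff_truncCatalan (q : R) (n i : ℕ) :
    coeff i (truncCatalan n (C q * X)) = if i < n then catalan i * q ^ i else 0 := by
  have h : ∀ j, ((catalan j : R⟦X⟧) * (C q * X) ^ j) = C (catalan j * q ^ j) * X ^ j := by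
    intro j
    rw [map_mul, map_natCast, map_pow, mul_pow, mul_assoc]
  simp only [truncCatalan, h, map_sum, coeff_C_mul, coeff_X_pow, mul_ite, mul_one, mul_zero]
  rw [Finset.sum_ite_eq]
  simp

theorem coeff_weightedCoeff (x q t : R) (s i : ℕ) :
    coeff i (weightedCoeff x q t s) =
      (stepWeight x q t i s - t) * shiftedSum x q t (s + 1) i := by
  have h : C (x - t) * (catalan s : R⟦X⟧) * C q ^ s * X ^ s =
      C ((x - t) * (catalan s * q ^ s)) * X ^ s := by
    rw [map_mul, map_mul, map_natCast, map_pow]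
    ring
  rw [weightedCoeff, h, map_add, coeff_C_mul, coeff_C_mul, coeff_X_pow, coeff_truncCatalan]
  rcases lt_trichotomy i s with h | rfl | h
  · rw [shiftedSum_of_le x q t h.le]
    simp [stepWeight, h, h.ne, h.ne']
  · rw [shiftedSum_of_le x q t le_rfl]
    simp [stepWeight]
  · simp [stepWeight, h.ne, h.ne', h.not_gt]

/-- The decomposition at the smallest letter, for generating functions. -/
theorem shiftedGF_eq (x q t : R) (s : ℕ) :
    shiftedGF x q t s =
      1 + X * ((weightedCoeff x q t s + C t * shiftedGF x q t (s + 1)) * shiftedGF x q t s) := by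
  ext n
  cases n with
  | zero => simp [shiftedGF, shiftedSum_zero]
  | succ n =>
    rw [map_add, coeff_succ_X_mul, coeff_mul, shiftedGF, coeff_mk, shiftedSum_succ, coeff_one,
      if_neg n.succ_ne_zero, zero_add]
    refine Finset.sum_congr rfl fun p _ => ?_
    rw [map_add, coeff_weightedCoeff, coeff_C_mul, shiftedGF, coeff_mk, coeff_mk]
    ring

theorem X_pow_dvd_sub_contFracTrunc {c : R} {K F : ℕ → R⟦X⟧}
    (hF : ∀ i, (1 - X * K i - C c * X * F (i + 1)) * F i = 1) (h i : ℕ) :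
    X ^ h ∣ F i - contFracTrunc c K h i := by
  induction h generalizing i with
  | zero => simp
  | succ h ih =>
    obtain ⟨d, hd⟩ := ih (i + 1)
    have hT := contFracTrunc_succ_mul c K h i
    refine ⟨C c * d * F i * contFracTrunc c K (h + 1) i, ?_⟩
    rw [pow_succ]
    linear_combination (-F i) * hT + contFracTrunc c K (h + 1) i * hF i +
      C c * X * F i * contFracTrunc c K (h + 1) i * hd

theorem isContFrac_of_forall_mul_eq_one {c : R} {K F : ℕ → R⟦X⟧}
    (hF : ∀ i, (1 - X * K i - C c * X * F (i + 1)) * F i = 1) : IsContFrac (F 0) c K := by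
  intro n
  filter_upwards [Filter.eventually_gt_atTop n] with h hn
  have := X_pow_dvd_iff.1 (X_pow_dvd_sub_contFracTrunc hF h 0) n hn
  rw [map_sub, sub_eq_zero] at this
  exact this.symm

theorem isContFrac_shiftedGF (x q t : R) :
    IsContFrac (shiftedGF x q t 0) t (weightedCoeff x q t) := by
  refine isContFrac_of_forall_mul_eq_one fun i => ?_
  linear_combination shiftedGF_eq x q t i

theorem permGF_pattern312 (x q : R) : permGF pattern312 x q = shiftedGF x q 1 0 := by
  ext n
  simp [permGF, shiftedGF, shiftedSum, shiftedWeight_zero_eq]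

theorem permGF_pattern231 (x q : R) : permGF pattern231 x q = shiftedGF x 1 q 0 := by
  ext n
  simp only [permGF, shiftedGF, shiftedSum, coeff_mk]
  refine Finset.sum_nbij' (fun π => π⁻¹) (fun π => π⁻¹) (fun π hπ => ?_) (fun π hπ => ?_)
    (fun π _ => inv_inv π) (fun π _ => inv_inv π) (fun π _ => ?_)
  · rwa [← inv_mem_avoiders231_iff, inv_inv]
  · rwa [inv_mem_avoiders231_iff]
  · rw [shiftedWeight_zero_eq_inv, inv_inv]

/-- Weights are homogeneous: multiplying all three by `q` multiplies the `n`-th coefficient by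
`q ^ n`. -/
theorem rescale_shiftedGF (c x q t : R) (s : ℕ) :
    rescale c (shiftedGF x q t s) = shiftedGF (c * x) (c * q) (c * t) s := by
  ext n
  rw [coeff_rescale, shiftedGF, shiftedGF, coeff_mk, coeff_mk, shiftedSum, shiftedSum,
    Finset.mul_sum]
  refine Finset.sum_congr rfl fun π _ => ?_
  have h : ∀ a b, stepWeight (c * x) (c * q) (c * t) a b = c * stepWeight x q t a b := by
    intro a b
    simp only [stepWeight, mul_ite]
  simp [shiftedWeight, h, Finset.prod_mul_distrib]

end series

theorem mainTheorem1 {R : Type*} [CommRing R] (x q : R) :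
    IsContFrac (permGF pattern312 x q) 1 (coeffK x q) ∧
    IsContFrac (permGF pattern312 x 1) 1
      (fun n => C (x - 1) * (catalan n : R⟦X⟧) * X ^ n) ∧
    (∀ u : Rˣ, (u : R) = q →
      permGF pattern231 x q = rescale q (permGF pattern312 (x * ↑u⁻¹) (↑u⁻¹ : R))) ∧
    IsContFrac (permGF pattern231 x q) q (coeffK' x q) := by
  refine ⟨?_, ?_, ?_, ?_⟩
  · rw [permGF_pattern312]
    exact isContFrac_shiftedGF x q 1
  · rw [permGF_pattern312]
    have h : (fun n => C (x - 1) * (catalan n : R⟦X⟧) * X ^ n) = weightedCoeff x 1 1 := by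
      funext n
      simp [weightedCoeff]
    rw [h]
    exact isContFrac_shiftedGF x 1 1
  · rintro u rfl
    rw [permGF_pattern231, permGF_pattern312, rescale_shiftedGF, mul_left_comm, Units.mul_inv,
      mul_one, mul_one]
  · rw [permGF_pattern231]
    have h : coeffK' x q = weightedCoeff x 1 q := by
      funext n
      simp [weightedCoeff, coeffK']
    rw [h]
    exact isContFrac_shiftedGF x 1 q
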